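/- Let $G$ be a finite simple graph, and for a vertex $v$ let $N[v]$ denote its closed neighborhood, i.e. $v$ together with its neighbors. A majority dominator coloring of $G$ is a proper vertex coloring in which, for every vertex $v$, there is a (nonempty) color class $A$ with $|N[v]\cap A|\ge \tfrac12|A|$. The majority dominator chromatic number $\chi_{md}(G)$ is the minimum number of color classes in a majority dominator coloring of $G$. Theorem. Let $n\ge 1$ and let $P_n$ be the path on $n$ vertices. Then $$ \chi_{md}(P_n)=\begin{cases} 1,& \text{if } n=1,\\ 2,& \text{if } 2\le n\le 5,\\ 3,& \text{if } 6\le n\le 10,\\ 4,& \text{if } 11\le n\le 13,\\ \left\lceil \frac{n}{6}\right\rceil+2,& \text{if } n\ge 14. \end{cases} $$ -/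

import Mathlib

/-- The closed neighborhood `N[v] = N(v) ∪ {v}`. -/
def closedNbhd {V : Type*} (G : SimpleGraph V) (v : V) : Set V :=
  G.neighborSet v ∪ {v}

/-- A proper coloring is a majority dominator coloring if every vertex `v` dominates at least half
of some (nonempty) color class `A`, that is, `2 * |N[v] ∩ A| ≥ |A|`. -/
def IsMajorityDominatorColoring {V α : Type*} [Finite V] {G : SimpleGraph V}
    (C : G.Coloring α) : Prop :=
  ∀ v : V, ∃ A ∈ C.colorClasses, A.ncard ≤ 2 * (closedNbhd G v ∩ A).ncard

/-- `G` has a majority dominator coloring with exactly `k` (nonempty) color classes. -/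
def HasMajorityDominatorColoring {V : Type*} [Finite V] (G : SimpleGraph V) (k : ℕ) : Prop :=
  ∃ C : G.Coloring (Fin k), Function.Surjective C ∧ IsMajorityDominatorColoring C

/-- The majority dominator chromatic number `χ_md(G)`: the minimum number of color classes in a
majority dominator coloring of `G`. -/
noncomputable def majorityDominatorChromaticNumber {V : Type*} [Finite V]
    (G : SimpleGraph V) : ℕ :=
  sInf {k : ℕ | HasMajorityDominatorColoring G k}

/-- The minimum is taken over a nonempty set: color all vertices differently. -/
theorem exists_hasMajorityDominatorColoring {V : Type*} [Finite V] (G : SimpleGraph V) :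
    ∃ k : ℕ, HasMajorityDominatorColoring G k := by
  obtain ⟨k, ⟨e⟩⟩ := Finite.exists_equiv_fin V
  refine ⟨k, SimpleGraph.Coloring.mk e (fun {v w} h he => h.ne (e.injective he)),
    e.surjective, fun v => ?_⟩
  refine ⟨{v}, ?_, ?_⟩
  · refine ⟨v, ?_⟩
    ext w
    exact ⟨fun h => by rw [Set.mem_singleton_iff.mp h]; rfl,
      fun h => e.injective h⟩
  · have : closedNbhd G v ∩ {v} = {v} := by
      ext w; simp [closedNbhd]
    rw [this, Set.ncard_singleton]
    norm_num

/-!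
Call a color class *small* if it has at most two members, *medium* if it has three or four, *large*
otherwise. In a properly colored path a closed neighborhood contains at most two vertices of a
class, and two only if these are the two neighbors of its center. So a small class is dominated by
`v` exactly if it meets `N[v]`, a medium class exactly if it contains both neighbors of `v`, and a
large class is never dominated (`pathDominates_iff`).

*Lower bounds.* Let a majority dominator coloring have `s` small classes, `t` classes of size three,
`u` of size four and `w` large ones; let `S` and `T` be the sets of vertices in small and medium
classes, so that `|S| ≤ 2s` and `|T| = 3t + 4u`.

* A small class is dominated by at most six vertices, a class of size three by at most two, a class
  of size four by at most three. Hence `n ≤ 6s + 2t + 3u` (`le_of_dominates`).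
* If `w ≤ 1`, the edges that avoid `S` inject into `T`, and therefore `n - 1 ≤ 2|S| + |T|`
  (`le_of_numClasses_large_le_one`). If `w = 0`, then `n = |S| + |T|`.
* An end vertex can only dominate a small class. If `|S| ≤ 2`, then `S` has all its members next to
  the ends, the vertices in the middle dominate medium classes, so that vertices at distance two
  there have equal colors; this forces `n ≤ 12` (`le_twelve_of_card_smallVertices_le_two`).

The bounds on the number of colors follow from these inequalities by linear arithmetic, except that
two colors on six vertices need a separate remark (`three_le_of_six_le`).

*Constructions.* Giving one color to the even vertices and pairing up consecutive odd vertices takes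
`⌊(n + 2) / 4⌋ + 1` colors, which is optimal for `2 ≤ n ≤ 13` except for `n = 10`, where a special
coloring exists. For `n ≥ 14` a dominating set of `⌈n / 3⌉` vertices is cut into pairs, and the
remaining vertices take two further colors.
-/

/-! ### Colorings of a path as functions on the natural numbers -/

/-- The vertices `u < n` of the path on `0, …, n - 1` that `f` gives the color `c`. -/
def pathClass (n : ℕ) (f : ℕ → ℕ) (c : ℕ) : Finset ℕ := {u ∈ Finset.range n | f u = c}

/-- The vertex `v` dominates at least half of the color class of `c`. As a proper coloring of a path
puts at most two vertices of a class into a closed neighborhood, and two only if these are the two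
neighbors of `v`, this means that either the class has at most two members, one of them in `N[v]`,
or it has at most four members and contains both `v - 1` and `v + 1`. -/
def PathDominates (n : ℕ) (f : ℕ → ℕ) (v c : ℕ) : Prop :=
  ((pathClass n f c).card ≤ 2 ∧ ∃ u ∈ pathClass n f c, u = v ∨ u + 1 = v ∨ v + 1 = u) ∨
  ((pathClass n f c).card ≤ 4 ∧ ∃ u ∈ pathClass n f c, u + 1 = v ∧ v + 1 ∈ pathClass n f c)

instance (n : ℕ) (f : ℕ → ℕ) (v c : ℕ) : Decidable (PathDominates n f v c) := by
  unfold PathDominates; infer_instance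

/-- The function `f`, restricted to `0, …, n - 1`, is a majority dominator coloring of the path with
colors below `k`. -/
structure IsPathColoring (n k : ℕ) (f : ℕ → ℕ) : Prop where
  lt : ∀ v < n, f v < k
  proper : ∀ v, v + 1 < n → f v ≠ f (v + 1)
  dominates : ∀ v < n, ∃ c < k, PathDominates n f v c

theorem mem_pathClass {n : ℕ} {f : ℕ → ℕ} {c u : ℕ} :
    u ∈ pathClass n f c ↔ u < n ∧ f u = c := by
  simp [pathClass]

theorem pathDominates_iff {n : ℕ} {f : ℕ → ℕ} (hf : ∀ v, v + 1 < n → f v ≠ f (v + 1))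
    {v c : ℕ} (hc : (pathClass n f c).Nonempty) :
    PathDominates n f v c ↔ (pathClass n f c).card ≤
      2 * {u ∈ pathClass n f c | u = v ∨ u + 1 = v ∨ v + 1 = u}.card := by
  set N := {u ∈ pathClass n f c | u = v ∨ u + 1 = v ∨ v + 1 = u} with hN
  have hmem : ∀ u, u ∈ N ↔ (u < n ∧ f u = c) ∧ (u = v ∨ u + 1 = v ∨ v + 1 = u) := by
    intro u; rw [hN, Finset.mem_filter, mem_pathClass]
  constructor
  · rintro (⟨h, u, hu, huv⟩ | ⟨h, u, hu, huv, hv⟩)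
    · have : 0 < N.card := Finset.card_pos.mpr ⟨u, Finset.mem_filter.mpr ⟨hu, huv⟩⟩
      omega
    · have : ({u, v + 1} : Finset ℕ).card ≤ N.card := by
        refine Finset.card_le_card fun x hx => ?_
        rw [Finset.mem_insert, Finset.mem_singleton] at hx
        rcases hx with rfl | rfl
        · exact Finset.mem_filter.mpr ⟨hu, .inr (.inl huv)⟩
        · exact Finset.mem_filter.mpr ⟨hv, .inr (.inr rfl)⟩
      rw [Finset.card_pair (by omega)] at this
      omega
  · intro h
    by_cases h2 : 2 ≤ N.card
    · have hle : N.card ≤ 2 ∧ v ∉ N := by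
        by_cases hv : v ∈ N
        · have : N ⊆ {v} := fun u hu => by
            rw [Finset.mem_singleton]
            have h1 := (hmem u).mp hu
            have h2 := (hmem v).mp hv
            rcases h1.2 with h3 | h3 | h3
            · exact h3
            · exact absurd (h1.1.2.trans (h2.1.2.symm.trans (by rw [h3])))
                (hf u (by omega))
            · exact absurd (h2.1.2.trans (h1.1.2.symm.trans (by rw [h3])))
                (hf v (by omega))
          have := Finset.card_le_card this
          rw [Finset.card_singleton] at this
          omega
        · refine ⟨?_, hv⟩
          have : N ⊆ {v - 1, v + 1} := fun u hu => by
            have h1 := ((hmem u).mp hu).2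
            have : u ≠ v := fun e => hv (e ▸ hu)
            rw [Finset.mem_insert, Finset.mem_singleton]
            omega
          exact (Finset.card_le_card this).trans Finset.card_le_two
      obtain ⟨x, hx, y, hy, hxy⟩ := Finset.one_lt_card.mp h2
      have hx' := (hmem x).mp hx
      have hy' := (hmem y).mp hy
      have hxv : x ≠ v := fun e => hle.2 (e ▸ hx)
      have hyv : y ≠ v := fun e => hle.2 (e ▸ hy)
      refine .inr ⟨by omega, ?_⟩
      rcases hx'.2 with h3 | h3 | h3
      · exact absurd h3 hxv
      · exact ⟨x, mem_pathClass.mpr hx'.1, h3, by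
          rw [show v + 1 = y by omega]; exact mem_pathClass.mpr hy'.1⟩
      · exact ⟨y, mem_pathClass.mpr hy'.1, by omega, by
          rw [h3]; exact mem_pathClass.mpr hx'.1⟩
    · have h0 := Finset.card_pos.mpr hc
      obtain ⟨u, hu⟩ := Finset.card_pos.mp (show 0 < N.card by omega)
      have := (hmem u).mp hu
      exact .inl ⟨by omega, u, mem_pathClass.mpr this.1, this.2⟩

/-- Passage from `Fin n` to `ℕ`: subsets of a color class have the same size on either side. -/
theorem ncard_fin_eq {n : ℕ} (p : ℕ → Prop) [DecidablePred p] :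
    {u : Fin n | p u}.ncard = {u ∈ Finset.range n | p u}.card := by
  rw [← Set.ncard_coe_finset, ← Set.ncard_image_of_injective _ Fin.val_injective]
  congr 1
  ext x
  simp only [Set.mem_image, Set.mem_ofPred_eq, Finset.coe_filter, Finset.mem_range]
  exact ⟨fun ⟨u, hu, e⟩ => e ▸ ⟨u.2, hu⟩, fun h => ⟨⟨x, h.1⟩, h.2, rfl⟩⟩

theorem hasMajorityDominatorColoring_pathGraph_iff {n k : ℕ} :
    HasMajorityDominatorColoring (SimpleGraph.pathGraph n) k ↔
      ∃ f, IsPathColoring n k f ∧ ∀ c < k, ∃ v < n, f v = c := by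
  have key : ∀ (C : (SimpleGraph.pathGraph n).Coloring (Fin k)) (f : ℕ → ℕ)
      (_ : ∀ u : Fin n, f u = C u) (_ : ∀ v, v + 1 < n → f v ≠ f (v + 1)) (v : Fin n)
      (c : Fin k) (_ : ∃ v, C v = c),
      {u | C u = c}.ncard ≤ 2 * (closedNbhd (SimpleGraph.pathGraph n) v ∩ {u | C u = c}).ncard ↔
        PathDominates n f v c := by
    rintro C f hfC hf v c ⟨v₀, hv₀⟩
    have h1 : {u | C u = c} = {u : Fin n | f u = c} := by
      ext u; simp [hfC, Fin.ext_iff]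
    have h2 : closedNbhd (SimpleGraph.pathGraph n) v ∩ {u | C u = c} =
        {u : Fin n | f u = c ∧ ((u : ℕ) = v ∨ (u : ℕ) + 1 = v ∨ (v : ℕ) + 1 = u)} := by
      ext u
      simp only [closedNbhd, Set.mem_inter_iff, Set.mem_union, SimpleGraph.mem_neighborSet,
        SimpleGraph.pathGraph_adj, Set.mem_singleton_iff, Set.mem_ofPred_eq, hfC, Fin.ext_iff]
      tauto
    rw [h2, h1, ncard_fin_eq (fun u => f u = c),
      ncard_fin_eq (fun u => f u = c ∧ (u = (v : ℕ) ∨ u + 1 = (v : ℕ) ∨ (v : ℕ) + 1 = u)),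
      pathDominates_iff hf ⟨v₀, mem_pathClass.mpr ⟨v₀.2, by rw [hfC, hv₀]⟩⟩,
      pathClass, Finset.filter_filter]
  constructor
  · rintro ⟨C, hsurj, hC⟩
    have hfC : ∀ u : Fin n, (fun v => if h : v < n then (C ⟨v, h⟩ : ℕ) else 0) u = C u := by
      intro u; simp
    set f : ℕ → ℕ := fun v => if h : v < n then (C ⟨v, h⟩ : ℕ) else 0
    have hf : ∀ v, v + 1 < n → f v ≠ f (v + 1) := by
      intro v hv e
      have h1 := hfC ⟨v, by omega⟩
      have h2 := hfC ⟨v + 1, hv⟩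
      refine C.valid (v := ⟨v, by omega⟩) (w := ⟨v + 1, hv⟩) ?_ (Fin.ext (by
        rw [← h1, ← h2]; exact e))
      rw [SimpleGraph.pathGraph_adj]
      exact .inl rfl
    refine ⟨f, ⟨fun v hv => ?_, hf, fun v hv => ?_⟩, fun c hc => ?_⟩
    · have := hfC ⟨v, hv⟩
      simp only at this
      rw [this]; exact (C _).2
    · obtain ⟨A, ⟨w, rfl⟩, hA⟩ := hC ⟨v, hv⟩
      exact ⟨C w, (C w).2, (key C f hfC hf ⟨v, hv⟩ (C w) ⟨w, rfl⟩).mp hA⟩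
    · obtain ⟨v, hv⟩ := hsurj ⟨c, hc⟩
      exact ⟨v, v.2, by rw [hfC, hv]⟩
  · rintro ⟨f, hf, hsurj⟩
    let C : (SimpleGraph.pathGraph n).Coloring (Fin k) :=
      SimpleGraph.Coloring.mk (fun v => ⟨f v, hf.lt v v.2⟩) (by
        intro v w h e
        rw [Fin.mk.injEq] at e
        rw [SimpleGraph.pathGraph_adj] at h
        rcases h with h | h
        · exact hf.proper v (by omega) (by rw [h, e])
        · exact hf.proper w (by omega) (by rw [h, e]))
    have hCs : Function.Surjective C := by
      intro c
      obtain ⟨v, hv, e⟩ := hsurj c c.2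
      exact ⟨⟨v, hv⟩, Fin.ext e⟩
    refine ⟨C, hCs, fun v => ?_⟩
    obtain ⟨c, hc, h⟩ := hf.dominates v v.2
    obtain ⟨w, hw⟩ := hCs ⟨c, hc⟩
    refine ⟨{u | C u = ⟨c, hc⟩}, ⟨w, ?_⟩, ?_⟩
    · ext u; rw [← hw]; rfl
    · exact (key C f (fun _ => rfl) hf.proper v ⟨c, hc⟩ ⟨w, hw⟩).mpr h

/-! ### Constructions -/

/-- The even vertices form one class; the odd vertices, which dominate the path, form the classes
`{1, 3}`, `{5, 7}`, …, the last of which may be a singleton. -/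
theorem hasMajorityDominatorColoring_pathGraph_bipartite {n : ℕ} (h2 : 2 ≤ n) :
    HasMajorityDominatorColoring (SimpleGraph.pathGraph n) ((n + 2) / 4 + 1) := by
  let f : ℕ → ℕ := fun v => if v % 2 = 0 then 0 else 1 + v / 4
  have hcard : ∀ c, c ≠ 0 → (pathClass n f c).card ≤ 2 := fun c hc => by
    refine (Finset.card_le_card (t := {4 * (c - 1) + 1, 4 * (c - 1) + 3}) fun u hu => ?_).trans
      Finset.card_le_two
    rw [mem_pathClass] at hu
    rw [Finset.mem_insert, Finset.mem_singleton]
    simp only [f] at hu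
    split_ifs at hu <;> omega
  have hdom : ∀ u v, u < n → u % 2 = 1 → (u = v ∨ u + 1 = v ∨ v + 1 = u) →
      ∃ c < (n + 2) / 4 + 1, PathDominates n f v c := fun u v hu hodd huv =>
    ⟨1 + u / 4, by omega, .inl ⟨hcard _ (by omega), u,
      mem_pathClass.mpr ⟨hu, if_neg (by omega)⟩, huv⟩⟩
  rw [hasMajorityDominatorColoring_pathGraph_iff]
  refine ⟨f, ⟨fun v hv => ?_, fun v hv => ?_, fun v hv => ?_⟩, fun c hc => ?_⟩
  · simp only [f]; split_ifs <;> omega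
  · simp only [f]; split_ifs <;> omega
  · by_cases hv2 : v % 2 = 1
    · exact hdom v v hv hv2 (.inl rfl)
    · by_cases hv1 : v + 1 < n
      · exact hdom (v + 1) v hv1 (by omega) (.inr (.inr rfl))
      · exact hdom (v - 1) v (by omega) (by omega) (.inr (.inl (by omega)))
  · by_cases hc0 : c = 0
    · exact ⟨0, by omega, by simp [f, hc0]⟩
    · refine ⟨4 * (c - 1) + 1, by omega, ?_⟩
      simp only [f]; split_ifs <;> omega

/-- The coloring has the classes `{1, 8}`, `{0, 2, 4, 6}` and `{3, 5, 7, 9}`. The vertices `3`, `4`,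
`5` and `6`, which have no neighbor in the first class, dominate one of the others. -/
theorem hasMajorityDominatorColoring_pathGraph_ten :
    HasMajorityDominatorColoring (SimpleGraph.pathGraph 10) 3 := by
  rw [hasMajorityDominatorColoring_pathGraph_iff]
  refine ⟨fun v => if v = 1 ∨ v = 8 then 2 else if v = 9 then 1 else v % 2, ⟨?_, ?_, ?_⟩, ?_⟩
  · decide
  · intro v hv
    have : ∀ v < 9, (if v = 1 ∨ v = 8 then 2 else if v = 9 then 1 else v % 2) ≠
        if v + 1 = 1 ∨ v + 1 = 8 then 2 else if v + 1 = 9 then 1 else (v + 1) % 2 := by decide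
    exact this v (by omega)
  · decide
  · decide

/-- The vertices congruent to `1` modulo `3`, together with the last vertex if it is divisible by
`3`, dominate the path. They form classes of at most two members, consecutive ones being paired, and
the vertices congruent to `0` and `2` modulo `3` form two more classes. -/
theorem hasMajorityDominatorColoring_pathGraph_mod_three {n : ℕ} (h3 : 3 ≤ n) :
    HasMajorityDominatorColoring (SimpleGraph.pathGraph n) ((n + 5) / 6 + 2) := by
  let f : ℕ → ℕ := fun v =>
    if v % 3 = 1 ∨ (v % 3 = 0 ∧ v + 1 = n) then 2 + v / 6 else if v % 3 = 0 then 0 else 1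
  have hcard : ∀ c, 2 ≤ c → (pathClass n f c).card ≤ 2 := fun c hc => by
    -- In the first two cases the path ends inside the block of six, at a vertex divisible by `3`.
    have hsub : pathClass n f c ⊆
        if n = 6 * (c - 2) + 4 then {6 * (c - 2) + 1, 6 * (c - 2) + 3} else
        if n = 6 * (c - 2) + 1 then {6 * (c - 2)} else {6 * (c - 2) + 1, 6 * (c - 2) + 4} := by
      intro u hu
      rw [mem_pathClass] at hu
      simp only [f] at hu
      split_ifs at hu ⊢ <;> simp only [Finset.mem_insert, Finset.mem_singleton] <;> omega
    refine (Finset.card_le_card hsub).trans ?_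
    split_ifs
    · exact Finset.card_le_two
    · simp
    · exact Finset.card_le_two
  have hdom : ∀ u v, u < n → (u % 3 = 1 ∨ (u % 3 = 0 ∧ u + 1 = n)) →
      (u = v ∨ u + 1 = v ∨ v + 1 = u) →
      ∃ c < (n + 5) / 6 + 2, PathDominates n f v c := fun u v hu hmod huv =>
    ⟨2 + u / 6, by omega, .inl ⟨hcard _ (by omega), u,
      mem_pathClass.mpr ⟨hu, if_pos hmod⟩, huv⟩⟩
  rw [hasMajorityDominatorColoring_pathGraph_iff]
  refine ⟨f, ⟨fun v hv => ?_, fun v hv => ?_, fun v hv => ?_⟩, fun c hc => ?_⟩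
  · simp only [f]; split_ifs <;> omega
  · simp only [f]; split_ifs <;> omega
  · by_cases h1 : v % 3 = 1 ∨ (v % 3 = 0 ∧ v + 1 = n)
    · exact hdom v v hv h1 (.inl rfl)
    · by_cases h0 : v % 3 = 0
      · exact hdom (v + 1) v (by omega) (by omega) (.inr (.inr rfl))
      · exact hdom (v - 1) v (by omega) (by omega) (.inr (.inl (by omega)))
  · by_cases hc0 : c = 0
    · exact ⟨0, by omega, (if_neg (by omega)).trans ((if_pos rfl).trans hc0.symm)⟩
    · by_cases hc1 : c = 1
      · exact ⟨2, by omega, (if_neg (by omega)).trans ((if_neg (by omega)).trans hc1.symm)⟩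
      · by_cases hn : 6 * (c - 2) + 1 < n
        · exact ⟨6 * (c - 2) + 1, hn, (if_pos (by omega)).trans (by omega)⟩
        · exact ⟨6 * (c - 2), by omega, (if_pos (by omega)).trans (by omega)⟩

/-! ### Small and medium color classes -/

/-- The vertices whose color class has at most two members. -/
def smallVertices (n : ℕ) (f : ℕ → ℕ) : Finset ℕ :=
  {v ∈ Finset.range n | (pathClass n f (f v)).card ≤ 2}

/-- The vertices whose color class has three or four members. -/
def mediumVertices (n : ℕ) (f : ℕ → ℕ) : Finset ℕ :=
  {v ∈ Finset.range n | 3 ≤ (pathClass n f (f v)).card ∧ (pathClass n f (f v)).card ≤ 4}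

/-- The number of colors below `k` whose class has a size satisfying `p`. -/
def numClasses (n k : ℕ) (f : ℕ → ℕ) (p : ℕ → Prop) [DecidablePred p] : ℕ :=
  {c ∈ Finset.range k | p (pathClass n f c).card}.card

namespace IsPathColoring

variable {n k : ℕ} {f : ℕ → ℕ}

/-- A vertex that dominates no small class has its two neighbors in a common medium class. In
particular an end vertex of the path always lies in or next to a small class. -/
theorem adj_small_or_medium (h : IsPathColoring n k f) {v : ℕ} (hv : v < n) :
    (∃ u ∈ smallVertices n f, u = v ∨ u + 1 = v ∨ v + 1 = u) ∨
    (1 ≤ v ∧ v + 1 < n ∧ f (v - 1) = f (v + 1) ∧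
      v - 1 ∈ mediumVertices n f ∧ v + 1 ∈ mediumVertices n f) := by
  obtain ⟨c, -, h1 | ⟨h4, u, hu, rfl, hv1⟩⟩ := h.dominates v hv
  · obtain ⟨h2, u, hu, huv⟩ := h1
    rw [mem_pathClass] at hu
    exact .inl ⟨u, Finset.mem_filter.mpr ⟨Finset.mem_range.mpr hu.1, by rwa [hu.2]⟩, huv⟩
  · rw [mem_pathClass] at hu hv1
    by_cases h2 : (pathClass n f c).card ≤ 2
    · exact .inl ⟨u, Finset.mem_filter.mpr ⟨Finset.mem_range.mpr hu.1, by rwa [hu.2]⟩,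
        .inr (.inl rfl)⟩
    · refine .inr ⟨by omega, hv1.1, ?_, ?_, ?_⟩
      · rw [Nat.add_sub_cancel, hu.2, hv1.2]
      · rw [Nat.add_sub_cancel]
        exact Finset.mem_filter.mpr ⟨Finset.mem_range.mpr hu.1, by rw [hu.2]; omega⟩
      · exact Finset.mem_filter.mpr ⟨Finset.mem_range.mpr hv1.1, by rw [hv1.2]; omega⟩

/-- If only two vertices lie in small classes, they serve the two ends of the path. -/
theorem not_mem_smallVertices (h : IsPathColoring n k f) (hS : (smallVertices n f).card ≤ 2)
    {v : ℕ} (h2 : 2 ≤ v) (h3 : v + 3 ≤ n) : v ∉ smallVertices n f := by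
  intro hv
  obtain ⟨a, ha, ha'⟩ := (h.adj_small_or_medium (v := 0) (by omega)).resolve_right (by omega)
  obtain ⟨b, hb, hb'⟩ := (h.adj_small_or_medium (v := n - 1) (by omega)).resolve_right (by omega)
  have : ({a, v, b} : Finset ℕ).card ≤ (smallVertices n f).card := by
    refine Finset.card_le_card fun x hx => ?_
    simp only [Finset.mem_insert, Finset.mem_singleton] at hx
    rcases hx with rfl | rfl | rfl <;> assumption
  rw [Finset.card_eq_three.mpr ⟨a, v, b, by omega, by omega, by omega, rfl⟩] at this
  omega

/-- With only two vertices in small classes, the vertices `2`, `4`, `6`, `8`, `10` of a path on at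
least thirteen vertices would have the same color, and their class would be dominated although it
has more than four members. -/
theorem le_twelve_of_card_smallVertices_le_two (h : IsPathColoring n k f)
    (hS : (smallVertices n f).card ≤ 2) : n ≤ 12 := by
  by_contra! hn
  have step : ∀ v, 3 ≤ v → v ≤ 9 → f (v - 1) = f (v + 1) ∧ v - 1 ∈ mediumVertices n f := by
    intro v h3 h9
    obtain ⟨-, -, h1, h2, -⟩ := (h.adj_small_or_medium (v := v) (by omega)).resolve_left (by
      rintro ⟨u, hu, huv⟩
      exact h.not_mem_smallVertices hS (by omega) (by omega) hu)
    exact ⟨h1, h2⟩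
  have h3 := step 3 (by omega) (by omega)
  have h5 := step 5 (by omega) (by omega)
  have h7 := step 7 (by omega) (by omega)
  have h9 := step 9 (by omega) (by omega)
  have hle : (pathClass n f (f 2)).card ≤ 4 := (Finset.mem_filter.mp h3.2).2.2
  have : ({2, 4, 6, 8, 10} : Finset ℕ).card ≤ (pathClass n f (f 2)).card := by
    refine Finset.card_le_card fun x hx => ?_
    simp only [Finset.mem_insert, Finset.mem_singleton] at hx
    rw [mem_pathClass]
    norm_num at h3 h5 h7 h9
    rcases hx with rfl | rfl | rfl | rfl | rfl <;> refine ⟨by omega, by simp [*]⟩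
  have h5 : ({2, 4, 6, 8, 10} : Finset ℕ).card = 5 := rfl
  omega

/-- If there is at most one class of size five or more, an edge avoiding the small classes has an
end in a medium class, and these edges can be assigned distinct vertices in medium classes. -/
theorem le_of_numClasses_large_le_one (h : IsPathColoring n k f)
    (hw : numClasses n k f (5 ≤ ·) ≤ 1) :
    n ≤ 2 * (smallVertices n f).card + (mediumVertices n f).card + 1 := by
  set S := smallVertices n f with hSdef
  set T := mediumVertices n f with hTdef
  have hT : ∀ i, i + 1 < n → i ∉ S → i + 1 ∉ S → i ∉ T → i + 1 ∈ T := by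
    intro i hi hi1 hi2 hi3
    by_contra hi4
    simp only [S, T, smallVertices, mediumVertices, Finset.mem_filter, Finset.mem_range,
      not_and] at hi1 hi2 hi3 hi4
    have h1 := hi1 (by omega)
    have h2 := hi2 (by omega)
    have h3 := hi3 (by omega) (by omega)
    have h4 := hi4 (by omega) (by omega)
    refine h.proper i hi (Finset.card_le_one.mp hw _ ?_ _ ?_) <;>
      refine Finset.mem_filter.mpr ⟨Finset.mem_range.mpr (h.lt _ (by omega)), by omega⟩
  -- An edge `{i, i + 1}` goes to `i` if possible and to `i + 1` otherwise. A collision requires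
  -- three consecutive vertices outside of `S` whose first one is not in `T`; but then the middle one
  -- dominates no class.
  have hE : {i ∈ Finset.range (n - 1) | i ∉ S ∧ i + 1 ∉ S}.card ≤ T.card := by
    refine Finset.card_le_card_of_injOn (fun i => if i ∈ T then i else i + 1) ?_ ?_
    · intro i hi
      simp only [Finset.coe_filter, Finset.mem_range, Set.mem_ofPred_eq] at hi
      dsimp only
      split_ifs with h1
      · exact h1
      · exact hT i (by omega) hi.2.1 hi.2.2 h1
    · have aux : ∀ i, i + 2 < n → i ∉ S → i + 1 ∉ S → i + 2 ∉ S → i ∈ T := by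
        intro i hi h0 h1 h2
        refine (((h.adj_small_or_medium (v := i + 1) (by omega)).resolve_left ?_).2.2.2).1
        rintro ⟨u, hu, e | e | e⟩
        · exact h1 (e ▸ hu)
        · exact h0 (Nat.succ_injective e ▸ hu)
        · exact h2 (e ▸ hu)
      intro i hi j hj hij
      simp only [Finset.coe_filter, Finset.mem_range, Set.mem_ofPred_eq] at hi hj
      dsimp only at hij
      split_ifs at hij with h1 h2 h2
      · exact hij
      · exact absurd (aux j (by omega) hj.2.1 hj.2.2 (by rw [hij] at hi; exact hi.2.2)) h2
      · exact absurd (aux i (by omega) hi.2.1 hi.2.2 (by rw [← hij] at hj; exact hj.2.2)) h1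
      · omega
  have hS1 : {i ∈ Finset.range (n - 1) | i ∈ S}.card ≤ S.card :=
    Finset.card_le_card fun i hi => (Finset.mem_filter.mp hi).2
  have hS2 : {i ∈ Finset.range (n - 1) | i + 1 ∈ S}.card ≤ S.card :=
    Finset.card_le_card_of_injOn (· + 1) (fun i hi => (Finset.mem_filter.mp hi).2)
      (fun i _ j _ e => Nat.succ_injective e)
  have hsub : Finset.range (n - 1) ⊆ ({i ∈ Finset.range (n - 1) | i ∈ S} ∪
      {i ∈ Finset.range (n - 1) | i + 1 ∈ S}) ∪
      {i ∈ Finset.range (n - 1) | i ∉ S ∧ i + 1 ∉ S} := by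
    intro i hi
    simp only [Finset.mem_union, Finset.mem_filter]
    tauto
  have h1 := Finset.card_le_card hsub
  have h2 := Finset.card_union_le ({i ∈ Finset.range (n - 1) | i ∈ S} ∪
      {i ∈ Finset.range (n - 1) | i + 1 ∈ S}) {i ∈ Finset.range (n - 1) | i ∉ S ∧ i + 1 ∉ S}
  have h3 := Finset.card_union_le {i ∈ Finset.range (n - 1) | i ∈ S}
    {i ∈ Finset.range (n - 1) | i + 1 ∈ S}
  rw [Finset.card_range] at h1
  omega

/-! ### Counting vertices by color classes -/

/-- The vertices whose class has a size satisfying `p` are counted class by class. -/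
theorem card_filter_eq_sum (h : IsPathColoring n k f) (p : ℕ → Prop) [DecidablePred p] :
    {v ∈ Finset.range n | p (pathClass n f (f v)).card}.card =
      ∑ c ∈ Finset.range k with p (pathClass n f c).card, (pathClass n f c).card := by
  rw [Finset.card_eq_sum_card_fiberwise (f := f) (t := Finset.range k), Finset.sum_filter]
  · refine Finset.sum_congr rfl fun c _ => ?_
    rw [Finset.filter_filter]
    split_ifs with hc
    · congr 1
      ext v
      rw [mem_pathClass, Finset.mem_filter, Finset.mem_range]
      exact ⟨fun hv => ⟨hv.1, hv.2.2⟩, fun hv => ⟨hv.1, by rw [hv.2]; exact hc, hv.2⟩⟩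
    · refine Finset.card_eq_zero.mpr (Finset.filter_eq_empty_iff.mpr ?_)
      rintro v - ⟨hv, rfl⟩
      exact hc hv
  · intro v hv
    simp only [Finset.coe_filter, Finset.mem_range, Set.mem_ofPred_eq] at hv
    exact Finset.mem_coe.mpr (Finset.mem_range.mpr (h.lt v hv.1))

theorem card_smallVertices_le (h : IsPathColoring n k f) :
    (smallVertices n f).card ≤ 2 * numClasses n k f (· ≤ 2) := by
  rw [smallVertices, h.card_filter_eq_sum (· ≤ 2), numClasses, mul_comm, ← smul_eq_mul]
  exact Finset.sum_le_card_nsmul _ _ _ fun c hc => (Finset.mem_filter.mp hc).2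

theorem card_mediumVertices (h : IsPathColoring n k f) :
    (mediumVertices n f).card = 3 * numClasses n k f (· = 3) + 4 * numClasses n k f (· = 4) := by
  rw [mediumVertices, h.card_filter_eq_sum (fun a => 3 ≤ a ∧ a ≤ 4), numClasses, numClasses,
    Finset.card_filter, Finset.card_filter, Finset.mul_sum, Finset.mul_sum,
    ← Finset.sum_add_distrib, Finset.sum_filter]
  refine Finset.sum_congr rfl fun c _ => ?_
  split_ifs <;> omega

theorem numClasses_add (n k : ℕ) (f : ℕ → ℕ) :
    numClasses n k f (· ≤ 2) + numClasses n k f (· = 3) + numClasses n k f (· = 4) +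
      numClasses n k f (5 ≤ ·) = k := by
  simp only [numClasses, Finset.card_filter]
  rw [← Finset.sum_add_distrib, ← Finset.sum_add_distrib, ← Finset.sum_add_distrib]
  rw [Finset.sum_congr rfl (g := fun _ => 1) fun c _ => by split_ifs <;> omega]
  simp

theorem eq_of_numClasses_large_eq_zero (h : IsPathColoring n k f)
    (hw : numClasses n k f (5 ≤ ·) = 0) :
    n = (smallVertices n f).card + (mediumVertices n f).card := by
  rw [smallVertices, mediumVertices, ← Finset.card_union_of_disjoint]
  · rw [← Finset.filter_or, Finset.filter_true_of_mem, Finset.card_range]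
    intro v hv
    by_contra hv'
    have := Finset.filter_eq_empty_iff.mp (Finset.card_eq_zero.mp hw)
      (Finset.mem_range.mpr (h.lt v (Finset.mem_range.mp hv)))
    omega
  · refine Finset.disjoint_filter.mpr fun v _ => ?_
    omega

/-- A class of size at most two meets `N[v]` for at most six vertices `v`. A class of size three or
four is dominated by fewer vertices `v` than it has members, as `v + 1` is a member other than the
smallest one. -/
theorem card_dominated_le (c : ℕ) :
    {v ∈ Finset.range n | PathDominates n f v c}.card ≤
      6 * (if (pathClass n f c).card ≤ 2 then 1 else 0) +
      2 * (if (pathClass n f c).card = 3 then 1 else 0) +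
      3 * (if (pathClass n f c).card = 4 then 1 else 0) := by
  set A := pathClass n f c
  by_cases h2 : A.card ≤ 2
  · have hsub : {v ∈ Finset.range n | PathDominates n f v c} ⊆
        A.biUnion fun u => {u - 1, u, u + 1} := by
      intro v hv
      rw [Finset.mem_biUnion]
      simp only [Finset.mem_insert, Finset.mem_singleton]
      rcases (Finset.mem_filter.mp hv).2 with ⟨-, u, hu, huv⟩ | ⟨-, u, hu, huv, -⟩ <;>
        exact ⟨u, hu, by omega⟩
    have := (Finset.card_le_card hsub).trans
      (Finset.card_biUnion_le_card_mul A _ 3 fun u _ => Finset.card_le_three)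
    rw [if_pos h2]
    omega
  · by_cases h4 : A.card ≤ 4
    · have hne : A.Nonempty := Finset.card_pos.mp (by omega)
      have hle : {v ∈ Finset.range n | PathDominates n f v c}.card ≤
          (A.erase (A.min' hne)).card := by
        refine Finset.card_le_card_of_injOn (· + 1) (fun v hv => ?_)
          (fun i _ j _ e => Nat.succ_injective e)
        rcases (Finset.mem_filter.mp hv).2 with ⟨h, -⟩ | ⟨-, u, hu, huv, hv1⟩
        · exact absurd h h2
        · refine Finset.mem_coe.mpr (Finset.mem_erase.mpr ⟨?_, hv1⟩)
          have := Finset.min'_le A u hu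
          dsimp only
          omega
      rw [Finset.card_erase_of_mem (Finset.min'_mem _ _)] at hle
      split_ifs <;> omega
    · rw [Finset.filter_false_of_mem, Finset.card_empty]
      · omega
      · rintro v - (⟨h, -⟩ | ⟨h, -⟩)
        · exact h2 h
        · exact h4 h

theorem le_of_dominates (h : IsPathColoring n k f) :
    n ≤ 6 * numClasses n k f (· ≤ 2) + 2 * numClasses n k f (· = 3) +
      3 * numClasses n k f (· = 4) := by
  have hsub : Finset.range n ⊆ (Finset.range k).biUnion fun c =>
      {v ∈ Finset.range n | PathDominates n f v c} := by
    intro v hv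
    obtain ⟨c, hc, hvc⟩ := h.dominates v (Finset.mem_range.mp hv)
    exact Finset.mem_biUnion.mpr ⟨c, Finset.mem_range.mpr hc, Finset.mem_filter.mpr ⟨hv, hvc⟩⟩
  have h1 := ((Finset.card_le_card hsub).trans Finset.card_biUnion_le).trans
    (Finset.sum_le_sum fun c _ => card_dominated_le (n := n) (f := f) c)
  rw [Finset.card_range, Finset.sum_add_distrib, Finset.sum_add_distrib, ← Finset.mul_sum,
    ← Finset.mul_sum, ← Finset.mul_sum] at h1
  simpa only [numClasses, Finset.card_filter] using h1

theorem card_smallVertices_pos (h : IsPathColoring n k f) (hn : 1 ≤ n) :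
    0 < (smallVertices n f).card := by
  obtain ⟨u, hu, -⟩ := (h.adj_small_or_medium (v := 0) (by omega)).resolve_right (by omega)
  exact Finset.card_pos.mpr ⟨u, hu⟩

/-! ### Lower bounds -/

/-- With two colors, the two middle vertices of a path on at least six vertices would both have
to lie outside of a class of size at most two, hence in the same class. -/
theorem three_le_of_six_le (h : IsPathColoring n k f) (hn : 6 ≤ n) : 3 ≤ k := by
  by_contra! hk
  have hadd := numClasses_add n k f
  have hpos := h.card_smallVertices_pos (by omega)
  have hS := h.card_smallVertices_le
  have hT := h.card_mediumVertices
  have h0 := h.eq_of_numClasses_large_eq_zero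
  have h1 := h.le_of_numClasses_large_le_one
  -- Two small classes account for at most four vertices, so only one of the two can be small.
  have hS2 : (smallVertices n f).card ≤ 2 := by omega
  have h2 := h.not_mem_smallVertices hS2 (v := 2) (by omega) (by omega)
  have h3 := h.not_mem_smallVertices hS2 (v := 3) (by omega) (by omega)
  obtain ⟨u, hu⟩ := Finset.card_pos.mp hpos
  rw [smallVertices, Finset.mem_filter, Finset.mem_range] at h2 h3 hu
  have e2 : f 2 ≠ f u := fun e => h2 ⟨by omega, e ▸ hu.2⟩
  have e3 : f 3 ≠ f u := fun e => h3 ⟨by omega, e ▸ hu.2⟩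
  have : f 2 ≠ f 3 := h.proper 2 (by omega)
  have := h.lt 2 (by omega)
  have := h.lt 3 (by omega)
  have := h.lt u hu.1
  omega

theorem four_le_of_eleven_le (h : IsPathColoring n k f) (hn : 11 ≤ n) : 4 ≤ k := by
  have hadd := numClasses_add n k f
  have hpos := h.card_smallVertices_pos (by omega)
  have hS := h.card_smallVertices_le
  have hT := h.card_mediumVertices
  have h0 := h.eq_of_numClasses_large_eq_zero
  have h1 := h.le_of_numClasses_large_le_one
  have hdom := h.le_of_dominates
  omega

theorem add_two_le_of_fourteen_le (h : IsPathColoring n k f) (hn : 14 ≤ n) :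
    (n + 5) / 6 + 2 ≤ k := by
  have hadd := numClasses_add n k f
  have h12 := h.le_twelve_of_card_smallVertices_le_two
  have hS := h.card_smallVertices_le
  have hT := h.card_mediumVertices
  have h0 := h.eq_of_numClasses_large_eq_zero
  have h1 := h.le_of_numClasses_large_le_one
  have hdom := h.le_of_dominates
  -- With fewer colors the counts leave only `n = 14` with one small class and three classes of size
  -- four, which `h12` excludes.
  omega

end IsPathColoring

/-! ### The chromatic number -/

theorem majorityDominatorChromaticNumber_pathGraph_eq {n k : ℕ}
    (hk : HasMajorityDominatorColoring (SimpleGraph.pathGraph n) k)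
    (hmin : ∀ l f, IsPathColoring n l f → k ≤ l) :
    majorityDominatorChromaticNumber (SimpleGraph.pathGraph n) = k := by
  refine le_antisymm (Nat.sInf_le hk) (le_csInf ⟨k, hk⟩ fun l hl => ?_)
  obtain ⟨f, hf, -⟩ := hasMajorityDominatorColoring_pathGraph_iff.mp hl
  exact hmin l f hf

theorem mainTheorem1 (n : ℕ) :
    (n = 1 → majorityDominatorChromaticNumber (SimpleGraph.pathGraph n) = 1) ∧
    (2 ≤ n ∧ n ≤ 5 → majorityDominatorChromaticNumber (SimpleGraph.pathGraph n) = 2) ∧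
    (6 ≤ n ∧ n ≤ 10 → majorityDominatorChromaticNumber (SimpleGraph.pathGraph n) = 3) ∧
    (11 ≤ n ∧ n ≤ 13 → majorityDominatorChromaticNumber (SimpleGraph.pathGraph n) = 4) ∧
    (14 ≤ n → majorityDominatorChromaticNumber (SimpleGraph.pathGraph n) =
      ⌈(n : ℚ) / 6⌉₊ + 2) := by
  refine ⟨?_, ?_, ?_, ?_, fun hn => ?_⟩
  · rintro rfl
    refine majorityDominatorChromaticNumber_pathGraph_eq ?_ fun l f hf =>
      (Nat.zero_le _).trans_lt (hf.lt 0 one_pos)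
    rw [hasMajorityDominatorColoring_pathGraph_iff]
    exact ⟨fun _ => 0, ⟨by decide, fun v hv => by omega, by decide⟩, by decide⟩
  · rintro ⟨h2, h5⟩
    refine majorityDominatorChromaticNumber_pathGraph_eq ?_ fun l f hf => ?_
    · convert hasMajorityDominatorColoring_pathGraph_bipartite h2 using 1
      omega
    · have := hf.proper 0 (by omega)
      have := hf.lt 0 (by omega)
      have := hf.lt (0 + 1) (by omega)
      omega
  · rintro ⟨h6, h10⟩
    refine majorityDominatorChromaticNumber_pathGraph_eq ?_ fun l f hf => hf.three_le_of_six_le h6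
    rcases h10.eq_or_lt with rfl | h9
    · exact hasMajorityDominatorColoring_pathGraph_ten
    · convert hasMajorityDominatorColoring_pathGraph_bipartite (n := n) (by omega) using 1
      omega
  · rintro ⟨h11, h13⟩
    refine majorityDominatorChromaticNumber_pathGraph_eq ?_ fun l f hf =>
      hf.four_le_of_eleven_le h11
    convert hasMajorityDominatorColoring_pathGraph_bipartite (n := n) (by omega) using 1
    omega
  · have hceil : ⌈(n : ℚ) / 6⌉₊ = (n + 5) / 6 := by
      obtain ⟨m, hm⟩ : ∃ m, (n + 5) / 6 = m + 1 := ⟨(n + 5) / 6 - 1, by omega⟩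
      rw [hm, Nat.ceil_eq_iff (by omega), Nat.add_sub_cancel, div_le_iff₀ (by norm_num),
        lt_div_iff₀ (by norm_num)]
      exact ⟨by exact_mod_cast (by omega : m * 6 < n),
        by exact_mod_cast (by omega : n ≤ (m + 1) * 6)⟩
    rw [hceil]
    exact majorityDominatorChromaticNumber_pathGraph_eq
      (hasMajorityDominatorColoring_pathGraph_mod_three (by omega))
      fun l f hf => hf.add_two_le_of_fourteen_le hn
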